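/- Let $k$ be an algebraically closed field and let $A=\bigoplus_{i\ge 0}A_i$ be a non-negatively graded finite-dimensional $k$-algebra which is basic. All modules are left modules. Assume that $A_0$ is self-injective, i.e. every projective $A_0$-module is injective. Let $\{e_\lambda\}_{\lambda\in\Lambda}\subset A_0$ be a finite complete set of primitive orthogonal idempotents of $A$ (so, $A$ being basic, the modules $P_\lambda=Ae_\lambda$ are pairwise non-isomorphic), and let $\le$ be a partial order on $\Lambda$. For $\lambda\in\Lambda$ the standard module is $$\Delta_\lambda=P_\lambda\Big/\sum_{\mu\not\le\lambda}\operatorname{tr}_{P_\mu}(P_\lambda),$$ where $\operatorname{tr}_{P_\mu}(P_\lambda)$ is the sum of the images of all homomorphisms $P_\mu\to P_\lambda$; it inherits a grading from $A$. An algebra with a complete set of primitive orthogonal idempotents indexed by a poset $(\Lambda,\le)$, whose indecomposable projectives $P_\lambda$ are pairwise non-isomorphic, is called standardly stratified with respect to $\le$ if for every $\lambda$ the kernel of $P_\lambda\to\Delta_\lambda$ has a finite filtration whose factors are isomorphic to modules $\Delta_\mu$ with $\mu>\lambda$. A graded $A$-module $M$ is called Koszul if it is generated in degree $0$ and has a graded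 projective resolution $\cdots\to P^1\to P^0\to M\to 0$ in which each $P^n$ is generated in degree $n$. Regard $A_0$ as the $A$-module $A/\bigoplus_{i\ge1}A_i$. Suppose that $A$ is standardly stratified with respect to $\le$ and that all standard modules $\Delta_\lambda$ are concentrated in degree $0$ and Koszul. Then: 1. $A_0\cong\Delta:=\bigoplus_{\lambda\in\Lambda}\Delta_\lambda$ as $A$-modules. 2. Let $\Gamma=\operatorname{Ext}^*_A(A_0,A_0)=\bigoplus_{n\ge 0}\operatorname{Ext}^n_A(A_0,A_0)$ with the Yoneda product ($x\cdot y$ means $y$ followed by $x$), and let $\varepsilon_\lambda\in\Gamma$ be the idempotent given by the endomorphism $x\mapsto xe_\lambda$ of $A_0$, so that $\Gamma\varepsilon_\lambda\cong\operatorname{Ext}^*_A(A_0e_\lambda,A_0)$. Then $\Gamma$ is finite-dimensional, $\{\varepsilon_\lambda\}_{\lambda\in\Lambda}$ is a complete set of primitive orthogonal idempotents of $\Gamma$ with the modules $\Gamma\varepsilon_\lambda$ pairwise non-isomorphic, and $\Gamma$ is standardly stratified with respect to $(\{\varepsilon_\lambda\}_{\lambda\in\Lambda},\le^{\mathrm{op}})$.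 -/

import Mathlib

open CategoryTheory DirectSum

universe u w

/-! ### Idempotents, indecomposable projectives, standard modules -/

section Stratification

variable {R : Type u} [Ring R]

/-- An idempotent `e ≠ 0` is primitive if it is not the sum of two nonzero orthogonal idempotents. -/
def IsPrimitiveIdem (e : R) : Prop :=
  IsIdempotentElem e ∧ e ≠ 0 ∧
    ∀ f g : R, IsIdempotentElem f → IsIdempotentElem g → f * g = 0 → g * f = 0 → f + g = e →
      f = 0 ∨ g = 0

variable {Λ : Type w}

/-- The projective left module `P_l = R e_l`. -/
abbrev projMod (e : Λ → R) (l : Λ) : Submodule R R := Submodule.span R {e l}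

/-- `e` is a complete set of primitive orthogonal idempotents of the ring `R`, and `R` is basic:
the modules `R e_l` are pairwise non-isomorphic. -/
structure IsBasicSystem [Fintype Λ] (e : Λ → R) : Prop where
  complete : CompleteOrthogonalIdempotents e
  primitive : ∀ l, IsPrimitiveIdem (e l)
  basic : ∀ l m, Nonempty (projMod e l ≃ₗ[R] projMod e m) → l = m

/-- The trace of `N` in `M`: the sum of the images of all homomorphisms `N → M`. -/
def traceIn (R : Type u) [Ring R] (N M : Type*) [AddCommGroup N] [Module R N]
    [AddCommGroup M] [Module R M] : Submodule R M :=
  ⨆ f : N →ₗ[R] M, LinearMap.range f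

variable [PartialOrder Λ]

/-- The submodule `∑_{m ≰ l} tr_{P_m}(P_l)` of `P_l`, that is, the kernel of `P_l → Δ_l`. -/
def stdKer (e : Λ → R) (l : Λ) : Submodule R (projMod e l) :=
  ⨆ m : Λ, ⨆ _ : ¬ m ≤ l, traceIn R (projMod e m) (projMod e l)

/-- The standard module `Δ_l = P_l / ∑_{m ≰ l} tr_{P_m}(P_l)`. -/
abbrev stdMod (e : Λ → R) (l : Λ) : Type u := projMod e l ⧸ stdKer e l

/-- `R` is standardly stratified with respect to the poset `Λ`: for each `l` the kernel of
`P_l → Δ_l` has a finite filtration whose factors are standard modules `Δ_m` with `l < m`. -/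
def IsStandardlyStratified (e : Λ → R) : Prop :=
  ∀ l : Λ, ∃ (n : ℕ) (F : ℕ → Submodule R (projMod e l)),
    F 0 = ⊥ ∧ F n = stdKer e l ∧
    ∀ i < n, F i ≤ F (i + 1) ∧
      ∃ m : Λ, l < m ∧
        Nonempty ((F (i + 1) ⧸ (F i).submoduleOf (F (i + 1))) ≃ₗ[R] stdMod e m)

end Stratification

/-- A ring is (left) self-injective if every projective left module is injective. -/
def IsSelfInjective (R : Type u) [Ring R] : Prop :=
  ∀ (P : Type u) [AddCommGroup P] [Module R P], Module.Projective R P → Module.Injective R P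

/-! ### Graded modules and Koszul modules -/

section Graded

variable {k : Type w} [Field k] {A : Type u} [Ring A] [Algebra k A] (𝒜 : ℕ → Submodule k A)

/-- `ℳ` makes the `A`-module `M` a `ℤ`-graded module over the graded algebra `(A, 𝒜)`.
As `k ⊆ A_0`, the pieces `ℳ i` are automatically `k`-subspaces. -/
structure IsModuleGrading {M : Type*} [AddCommGroup M] [Module A M] (ℳ : ℤ → AddSubgroup M) :
    Prop where
  isInternal : DirectSum.IsInternal ℳ
  smul_mem : ∀ (i : ℕ) (j : ℤ) (a : A) (x : M), a ∈ 𝒜 i → x ∈ ℳ j → a • x ∈ ℳ (i + j)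

/-- `M` is generated in degree `s`, i.e. `M = A · M_s`. -/
def GeneratedInDegree (A : Type u) [Ring A] {M : Type*} [AddCommGroup M] [Module A M]
    (ℳ : ℤ → AddSubgroup M) (s : ℤ) : Prop :=
  Submodule.span A (ℳ s : Set M) = ⊤

/-- `M` is concentrated in degree `s`. -/
def ConcentratedInDegree {M : Type*} [AddCommGroup M] (ℳ : ℤ → AddSubgroup M) (s : ℤ) : Prop :=
  ∀ i, i ≠ s → ℳ i = ⊥

/-- A homomorphism of degree zero. -/
def IsGradedHom {A : Type u} [Ring A] {M N : Type*} [AddCommGroup M] [Module A M]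
    [AddCommGroup N] [Module A N] (ℳ : ℤ → AddSubgroup M) (𝒩 : ℤ → AddSubgroup N)
    (f : M →ₗ[A] N) : Prop :=
  ∀ i, ∀ x ∈ ℳ i, f x ∈ 𝒩 i

/-- A bundled graded `A`-module. -/
structure GrMod where
  carrier : Type u
  [grp : AddCommGroup carrier]
  [mod : Module A carrier]
  deg : ℤ → AddSubgroup carrier
  grading : IsModuleGrading 𝒜 deg

attribute [instance] GrMod.grp GrMod.mod

/-- A graded module `M` is Koszul if it is generated in degree `0` and has a graded projective
resolution `⋯ → P 1 → P 0 → M → 0` such that `P n` is generated in degree `n` for all `n`. -/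
def IsKoszulModule {M : Type u} [AddCommGroup M] [Module A M] (ℳ : ℤ → AddSubgroup M) : Prop :=
  IsModuleGrading 𝒜 ℳ ∧ GeneratedInDegree A ℳ 0 ∧
  ∃ (P : ℕ → GrMod 𝒜) (d : ∀ n, (P (n + 1)).carrier →ₗ[A] (P n).carrier)
    (ε : (P 0).carrier →ₗ[A] M),
    (∀ n, Module.Projective A (P n).carrier) ∧
    (∀ n, GeneratedInDegree A (P n).deg n) ∧
    (∀ n, IsGradedHom (P (n + 1)).deg (P n).deg (d n)) ∧
    IsGradedHom (P 0).deg ℳ ε ∧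
    Function.Surjective ε ∧ Function.Exact (d 0) ε ∧ ∀ n, Function.Exact (d (n + 1)) (d n)

/-- The grading of `A`, extended to `ℤ` by zero in negative degrees. -/
def algDeg (i : ℤ) : AddSubgroup A :=
  if 0 ≤ i then (𝒜 i.toNat).toAddSubgroup else ⊥

/-- The grading of `Δ_l` induced by that of `A`: the degree `i` part is the image of
`A_i ∩ A e_l`. -/
def stdDeg {Λ : Type*} [PartialOrder Λ] (e : Λ → A) (l : Λ) (i : ℤ) : AddSubgroup (stdMod e l) :=
  ((algDeg 𝒜 i).comap (projMod e l).subtype.toAddMonoidHom).map (stdKer e l).mkQ.toAddMonoidHom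

variable [GradedAlgebra 𝒜]

/-- The ideal `J = ⨁_{i ≥ 1} A_i`. -/
abbrev posIdeal : Submodule A A := (HomogeneousIdeal.irrelevant 𝒜).toIdeal

lemma posIdeal_mul_mem (a x : A) (hx : x ∈ posIdeal 𝒜) : x * a ∈ posIdeal 𝒜 := by
  have h0 : ∀ y : A, y ∈ posIdeal 𝒜 ↔ GradedRing.projZeroRingHom 𝒜 y = 0 := fun y => Iff.rfl
  rw [h0] at hx ⊢
  rw [map_mul, hx, zero_mul]

/-- `A_0` as a left `A`-module, namely the quotient `A / J`. -/
abbrev degZeroMod : Type u := A ⧸ posIdeal 𝒜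

/-- Right multiplication by `a` on `A_0 = A / J`, an endomorphism of left `A`-modules. -/
def rightMul (a : A) : degZeroMod 𝒜 →ₗ[A] degZeroMod 𝒜 :=
  Submodule.mapQ (posIdeal 𝒜) (posIdeal 𝒜) (LinearMap.toSpanSingleton A A a)
    (fun x hx => posIdeal_mul_mem 𝒜 a x hx)

end Graded

/-! ### The Yoneda algebra -/

section Yoneda

variable {C : Type*} [Category C] [Abelian C] [HasExt.{u} C]

/-- The Yoneda product: `x * y` is `x ∘ y`, i.e. `y` followed by `x`. -/
noncomputable instance yonedaGMul (X : C) :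
    GradedMonoid.GMul (fun n : ℕ => Abelian.Ext.{u} X X n) where
  mul {i j} x y := y.comp x (add_comm j i)

noncomputable instance yonedaGOne (X : C) :
    GradedMonoid.GOne (fun n : ℕ => Abelian.Ext.{u} X X n) where
  one := Abelian.Ext.mk₀ (𝟙 X)

lemma yoneda_sigma_ext (X : C) {n m : ℕ} (h : n = m) (x : Abelian.Ext.{u} X X n)
    (y : Abelian.Ext.{u} X X m)
    (hxy : x.comp (Abelian.Ext.mk₀ (𝟙 X)) (by simpa using h) = y) :
    (⟨n, x⟩ : GradedMonoid (fun n : ℕ => Abelian.Ext.{u} X X n)) = ⟨m, y⟩ := by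
  subst h
  rw [Abelian.Ext.comp_mk₀_id] at hxy
  rw [hxy]

noncomputable instance yonedaGMonoid (X : C) :
    GradedMonoid.GMonoid (fun n : ℕ => Abelian.Ext.{u} X X n) where
  one_mul := by
    rintro ⟨n, x⟩
    exact yoneda_sigma_ext X (zero_add n) (x.comp (Abelian.Ext.mk₀ (𝟙 X)) (add_comm n 0)) x (by
      refine (Abelian.Ext.comp_assoc x (Abelian.Ext.mk₀ (𝟙 X)) (Abelian.Ext.mk₀ (𝟙 X))
        (add_comm n 0) (add_zero 0) (by omega)).trans ?_
      rw [Abelian.Ext.mk₀_id_comp, Abelian.Ext.comp_mk₀_id])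
  mul_one := by
    rintro ⟨n, x⟩
    exact yoneda_sigma_ext X (add_zero n) ((Abelian.Ext.mk₀ (𝟙 X)).comp x (add_comm 0 n)) x (by
      rw [Abelian.Ext.comp_assoc_of_third_deg_zero, Abelian.Ext.comp_mk₀_id,
        Abelian.Ext.mk₀_id_comp])
  mul_assoc := by
    rintro ⟨n, x⟩ ⟨m, y⟩ ⟨p, z⟩
    exact yoneda_sigma_ext X (add_assoc n m p)
      (z.comp (y.comp x (add_comm m n)) (add_comm p (n + m)))
      ((z.comp y (add_comm p m)).comp x (add_comm (m + p) n)) (by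
        refine (Abelian.Ext.comp_assoc z (y.comp x (add_comm m n)) (Abelian.Ext.mk₀ (𝟙 X))
          (add_comm p (n + m)) (add_zero (n + m)) (by omega)).trans ?_
        rw [Abelian.Ext.comp_mk₀_id]
        exact (Abelian.Ext.comp_assoc z y x _ _ (by omega)).symm)

noncomputable instance yonedaGRing (X : C) :
    DirectSum.GRing (fun n : ℕ => Abelian.Ext.{u} X X n) where
  __ := yonedaGMonoid X
  mul_zero _ := Abelian.Ext.zero_comp ..
  zero_mul _ := Abelian.Ext.comp_zero ..
  mul_add _ _ _ := Abelian.Ext.add_comp ..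
  add_mul _ _ _ := Abelian.Ext.comp_add ..
  natCast n := (n • Abelian.Ext.mk₀ (𝟙 X) : Abelian.Ext.{u} X X 0)
  natCast_zero := zero_smul _ _
  natCast_succ _ := succ_nsmul _ _
  intCast n := (n • Abelian.Ext.mk₀ (𝟙 X) : Abelian.Ext.{u} X X 0)
  intCast_ofNat _ := natCast_zsmul _ _
  intCast_negSucc_ofNat _ := negSucc_zsmul _ _

/-- The Yoneda algebra `Ext^*(X, X) = ⨁ n, Ext^n(X, X)`. -/
abbrev YonedaAlgebra (X : C) : Type u := ⨁ n : ℕ, Abelian.Ext.{u} X X n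

noncomputable instance yonedaAlgebraAlgebra (k : Type w) [Field k] [Linear k C] (X : C) :
    Algebra k (YonedaAlgebra X) :=
  Algebra.ofModule
    (by
      intro r x y
      induction x using DirectSum.induction_on with
      | zero => simp
      | add x x' hx hx' => simp only [smul_add, add_mul, hx, hx']
      | of n x =>
        induction y using DirectSum.induction_on with
        | zero => simp
        | add y y' hy hy' => simp only [mul_add, smul_add, hy, hy']
        | of m y =>
          rw [← DirectSum.of_smul, DirectSum.of_mul_of, DirectSum.of_mul_of,
            ← DirectSum.of_smul]
          exact congrArg _ (Abelian.Ext.comp_smul y x (add_comm m n) r))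
    (by
      intro r x y
      induction x using DirectSum.induction_on with
      | zero => simp
      | add x x' hx hx' => simp only [smul_add, add_mul, hx, hx']
      | of n x =>
        induction y using DirectSum.induction_on with
        | zero => simp
        | add y y' hy hy' => simp only [mul_add, smul_add, hy, hy']
        | of m y =>
          rw [← DirectSum.of_smul, DirectSum.of_mul_of, DirectSum.of_mul_of,
            ← DirectSum.of_smul]
          exact congrArg _ (Abelian.Ext.smul_comp y x (add_comm m n) r))

end Yoneda

section Dual

variable {k : Type w} [Field k] {A : Type u} [Ring A] [Algebra k A] (𝒜 : ℕ → Submodule k A)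
  [GradedAlgebra 𝒜]

/-- The Yoneda algebra `Γ = Ext^*_A(A_0, A_0)`. -/
abbrev KoszulDual : Type u := YonedaAlgebra (ModuleCat.of A (degZeroMod 𝒜))

/-- The element of `Γ` in degree `0` given by an idempotent `e ∈ A_0`: the endomorphism `x ↦ x e`
of `A_0`, so that `Γ · dualIdem e = Ext^*_A(A_0 e, A_0)`. -/
noncomputable def dualIdem (e : A) : KoszulDual 𝒜 :=
  DirectSum.of (fun n : ℕ => Abelian.Ext.{u} (ModuleCat.of A (degZeroMod 𝒜))
    (ModuleCat.of A (degZeroMod 𝒜)) n) 0 (Abelian.Ext.mk₀ (ModuleCat.ofHom (rightMul 𝒜 e)))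

end Dual

/-! ### Primitive idempotents and their projective modules. -/

section Idempotents

variable {R : Type u} [Ring R]

/-! Write `J` for `posIdeal`. Everything rests on `mem_stdKer_iff`: the kernel of `P_l → Δ_l` is `J
∩ P_l`, so `Δ_l` is the summand `A_0 e_l` of `A_0`. Summing over `l` gives the first claim. That `J
∩ P_l` dies in `Δ_l` is concentration in degree `0`. Conversely, a linear resolution forces the
relations of `Δ_l` into `J`: comparing its first term with `P_l` yields `f ∈ e_l A e_l` such that
`stdKer · f ⊆ J` and the degree `0` part of `f` is idempotent. By primitivity this part is `0` or
`e_l`, and `0` is excluded because `Δ_l ≠ 0`.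

Consequently `ε_m Γ ε_l` is `Ext^*(Δ_l, Δ_m)`. Descending induction along the stratification
(`IsStandardlyStratified.stdMod_induction`) shows that it vanishes unless `l ≤ m`, is
finite-dimensional in each degree, and is zero in large degrees. So `Γ` is finite-dimensional and
directed. For the opposite order its standard modules are then the projectives themselves, the
stratification has only zero kernels to filter, and antisymmetry of the order separates the
projectives. Primitivity of `ε_l` is read off in degree `0`, where `Γ` is `A_0` with reversed
multiplication, because an idempotent with no degree `0` part vanishes. -/

lemma projMod_mul_idem {Λ : Type*} {e : Λ → R} {l : Λ} (hl : IsIdempotentElem (e l)) {x : R}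
    (hx : x ∈ projMod e l) : x * e l = x := by
  obtain ⟨a, rfl⟩ := Submodule.mem_span_singleton.mp hx
  rw [smul_eq_mul, mul_assoc, hl.eq]

/-- The canonical generator of `R e_l`. -/
def projGen {Λ : Type*} (e : Λ → R) (l : Λ) : projMod e l :=
  ⟨e l, Submodule.mem_span_singleton_self _⟩

/-- Right multiplication by `y ∈ R e_m`, as a homomorphism `R e_l → R e_m`. -/
def projMulRight {Λ : Type*} (e : Λ → R) (l : Λ) {m : Λ} (y : projMod e m) :
    projMod e l →ₗ[R] projMod e m :=
  (LinearMap.toSpanSingleton R (projMod e m) y).comp (projMod e l).subtype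

lemma projMod_eq_smul_gen {Λ : Type*} {e : Λ → R} {l : Λ} (hl : IsIdempotentElem (e l))
    (x : projMod e l) : x = (x : R) • projGen e l :=
  Subtype.ext (projMod_mul_idem hl x.2).symm

lemma map_projGen {Λ : Type*} {e : Λ → R} {l : Λ} (hl : IsIdempotentElem (e l))
    {M : Type*} [AddCommGroup M] [Module R M] (f : projMod e l →ₗ[R] M) :
    e l • f (projGen e l) = f (projGen e l) := by
  rw [← map_smul]; congr 1; exact Subtype.ext hl.eq

lemma projHom_apply {Λ : Type*} {e : Λ → R} {l : Λ} (hl : IsIdempotentElem (e l))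
    {M : Type*} [AddCommGroup M] [Module R M] (f : projMod e l →ₗ[R] M) (x : projMod e l) :
    f x = (x : R) • f (projGen e l) := by
  conv_lhs => rw [projMod_eq_smul_gen hl x, map_smul]

lemma projMod_projective {Λ : Type*} {e : Λ → R} {l : Λ} (hl : IsIdempotentElem (e l)) :
    Module.Projective R (projMod e l) := by
  refine Module.Projective.of_split (projMod e l).subtype
    (LinearMap.toSpanSingleton R (projMod e l) (projGen e l)) ?_
  ext x
  exact projMod_mul_idem hl x.2

/-- The projective module of a primitive idempotent is indecomposable. -/
lemma IsPrimitiveIdem.eq_bot_or_eq_top {Λ : Type*} {e : Λ → R} {l : Λ}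
    (hl : IsPrimitiveIdem (e l)) {U V : Submodule R (projMod e l)} (h : IsCompl U V) :
    (U = ⊥ ∧ V = ⊤) ∨ (U = ⊤ ∧ V = ⊥) := by
  have hg : projGen e l ∈ U ⊔ V := by rw [h.sup_eq_top]; trivial
  obtain ⟨u, hu, v, hv, huv⟩ := Submodule.mem_sup.mp hg
  have huv' : (u : R) + v = e l := congrArg Subtype.val huv
  have hue : (u : R) * e l = u := projMod_mul_idem hl.1 u.2
  have hve : (v : R) * e l = v := projMod_mul_idem hl.1 v.2
  have hzero : ∀ x, x ∈ U → x ∈ V → x = 0 := fun x h1 h2 => by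
    have : x ∈ U ⊓ V := ⟨h1, h2⟩
    rwa [h.inf_eq_bot, Submodule.mem_bot] at this
  -- Since `u + v = e l` and `u * e l = u`, the product `u v = u - u u` lies in `U ∩ V = 0`. With
  -- the symmetric statement, `e l` splits into orthogonal idempotents.
  have key1 : (u : R) • v = 0 := by
    refine hzero _ ?_ (V.smul_mem _ hv)
    have : (u : R) • v = u - (u : R) • u := by
      apply Subtype.ext
      simp only [Submodule.coe_smul, smul_eq_mul, AddSubgroupClass.coe_sub]
      rw [eq_sub_iff_add_eq, ← mul_add, add_comm, huv', hue]
    rw [this]; exact U.sub_mem hu (U.smul_mem _ hu)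
  have key2 : (v : R) • u = 0 := by
    refine hzero _ (U.smul_mem _ hu) ?_
    have : (v : R) • u = v - (v : R) • v := by
      apply Subtype.ext
      simp only [Submodule.coe_smul, smul_eq_mul, AddSubgroupClass.coe_sub]
      rw [eq_sub_iff_add_eq, ← mul_add, huv', hve]
    rw [this]; exact V.sub_mem hv (V.smul_mem _ hv)
  have k1 : (u : R) * v = 0 := congrArg Subtype.val key1
  have k2 : (v : R) * u = 0 := congrArg Subtype.val key2
  have iu : IsIdempotentElem (u : R) := by
    have := hue; rw [← huv', mul_add, k1, add_zero] at this; exact this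
  have iv : IsIdempotentElem (v : R) := by
    have := hve; rw [← huv', mul_add, k2, zero_add] at this; exact this
  have gen_top : ∀ W : Submodule R (projMod e l), projGen e l ∈ W → W = ⊤ := fun W hW =>
    top_unique fun x _ => by rw [projMod_eq_smul_gen hl.1 x]; exact W.smul_mem _ hW
  rcases hl.2.2 u v iu iv k1 k2 huv' with h0 | h0
  · left
    have hV : V = ⊤ := gen_top V (by rw [← huv, show u = 0 from Subtype.ext h0]; simpa using hv)
    refine ⟨?_, hV⟩
    have := h.inf_eq_bot; rwa [hV, inf_top_eq] at this
  · right
    have hU : U = ⊤ := gen_top U (by rw [← huv, show v = 0 from Subtype.ext h0]; simpa using hu)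
    refine ⟨hU, ?_⟩
    have := h.inf_eq_bot; rwa [hU, top_inf_eq] at this

/-- Fitting's lemma for the endomorphisms of an indecomposable projective module. -/
lemma IsPrimitiveIdem.bijective_or_isNilpotent [IsArtinianRing R] {Λ : Type*} {e : Λ → R} {l : Λ}
    (hl : IsPrimitiveIdem (e l)) (f : projMod e l →ₗ[R] projMod e l) :
    Function.Bijective f ∨ ∃ n, f ^ n = 0 := by
  have : IsNoetherianRing R := inferInstance
  obtain ⟨n, hn⟩ := Filter.eventually_atTop.mp f.eventually_isCompl_ker_pow_range_pow
  -- A positive exponent, so that a factor `f` can be split off the power on either side.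
  have hc := hn (n + 1) (by omega)
  rcases hl.eq_bot_or_eq_top hc with ⟨hk, hr⟩ | ⟨hk, hr⟩
  · left
    constructor
    · rw [← LinearMap.ker_eq_bot, eq_bot_iff, ← hk]
      intro x hx
      rw [LinearMap.mem_ker] at hx ⊢
      rw [pow_succ, Module.End.mul_apply, hx, map_zero]
    · rw [← LinearMap.range_eq_top, eq_top_iff, ← hr]
      rintro _ ⟨x, rfl⟩
      exact ⟨(f ^ n) x, by rw [pow_succ', Module.End.mul_apply]⟩
  · right
    exact ⟨n + 1, LinearMap.ker_eq_top.mp hk⟩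

/-- A homomorphism between non-isomorphic indecomposable projectives has its image in every
maximal submodule. -/
lemma range_le_of_isCoatom [IsArtinianRing R] {Λ : Type*} {e : Λ → R} {l m : Λ}
    (hl : IsPrimitiveIdem (e l)) (hm : IsPrimitiveIdem (e m))
    (hlm : ¬ Nonempty (projMod e l ≃ₗ[R] projMod e m))
    {M : Submodule R (projMod e l)} (hM : IsCoatom M) (f : projMod e m →ₗ[R] projMod e l) :
    LinearMap.range f ≤ M := by
  by_contra hf
  have hsup : M ⊔ LinearMap.range f = ⊤ := hM.2 _ (left_lt_sup.mpr hf)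
  obtain ⟨y, hy, _, ⟨x, rfl⟩, hxy⟩ := Submodule.mem_sup.mp
    (show projGen e l ∈ M ⊔ LinearMap.range f by rw [hsup]; trivial)
  -- By the choice of `x`, `f ∘ h` is the identity modulo `M`. It is therefore not nilpotent, hence
  -- bijective by Fitting, and `h` embeds `P_l` as a summand of the indecomposable `P_m`.
  let h : projMod e l →ₗ[R] projMod e m := projMulRight e l x
  have hfh : ∀ z, f (h z) - z ∈ M := fun z => by
    have e1 : h z = (z : R) • x := rfl
    have e3 : z = (z : R) • y + (z : R) • f x := by
      rw [← smul_add, hxy]; exact projMod_eq_smul_gen hl.1 z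
    have e2 : f (h z) - z = -((z : R) • y) := by
      rw [e1, map_smul]
      exact (congrArg ((z : R) • f x - ·) e3).trans (by abel)
    rw [e2]; exact M.neg_mem (M.smul_mem _ hy)
  have hbij : Function.Bijective (f.comp h) := by
    refine (hl.bijective_or_isNilpotent (f.comp h)).resolve_right ?_
    rintro ⟨n, hn⟩
    have hpow : ∀ n z, ((f.comp h) ^ n) z - z ∈ M := by
      intro n
      induction n with
      | zero => intro z; simp
      | succ n ih =>
        intro z
        have := M.add_mem (hfh (((f.comp h) ^ n) z)) (ih z)
        rw [sub_add_sub_cancel] at this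
        rwa [pow_succ', Module.End.mul_apply]
    apply hM.1
    rw [eq_top_iff]
    intro z _
    have := hpow n z
    rw [hn, LinearMap.zero_apply, zero_sub] at this
    simpa using M.neg_mem this
  have hinj : Function.Injective h := Function.Injective.of_comp (f := f) hbij.1
  have hsurj : Function.Surjective f := Function.Surjective.of_comp (g := h) hbij.2
  have hcompl : IsCompl (LinearMap.range h) (LinearMap.ker f) := by
    refine ⟨disjoint_iff.mpr (eq_bot_iff.mpr ?_), codisjoint_iff.mpr (eq_top_iff.mpr ?_)⟩
    · rintro _ ⟨⟨z, rfl⟩, hz⟩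
      have : z = 0 := hbij.1 (by simpa using hz)
      simp [this]
    · intro z _
      obtain ⟨t, ht⟩ := hbij.2 (f z)
      refine Submodule.mem_sup.mpr ⟨h t, ⟨t, rfl⟩, z - h t, ?_, by abel⟩
      rw [LinearMap.mem_ker, map_sub, sub_eq_zero]; exact ht.symm
  rcases hm.eq_bot_or_eq_top hcompl with ⟨hb, -⟩ | ⟨ht, -⟩
  · have : h (projGen e l) = 0 := by
      rw [← Submodule.mem_bot R, ← hb]; exact ⟨_, rfl⟩
    have h0 : projGen e l = 0 := hinj (by rw [this, map_zero])
    exact hl.2.1 (congrArg Subtype.val h0)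
  · exact hlm ⟨LinearEquiv.ofBijective h ⟨hinj, LinearMap.range_eq_top.mp ht⟩⟩

/-! ### Standard modules and directed rings. -/

variable {Λ : Type*} [PartialOrder Λ]

/-- Standard modules are nonzero. -/
lemma stdKer_ne_top [IsArtinianRing R] [Fintype Λ] {e : Λ → R} (he : IsBasicSystem e) (l : Λ) :
    stdKer e l ≠ ⊤ := by
  have : Nontrivial (projMod e l) :=
    ⟨⟨projGen e l, 0, fun h => (he.primitive l).2.1 (congrArg Subtype.val h)⟩⟩
  -- One maximal submodule contains all the traces: `m ≰ l` forces `m ≠ l`, so `P_m` and `P_l` are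
  -- not isomorphic.
  obtain ⟨M, hM⟩ := IsCoatomic.exists_coatom (Submodule R (projMod e l))
  have hle : stdKer e l ≤ M := by
    refine iSup_le fun m => iSup_le fun hm => iSup_le fun f => ?_
    refine range_le_of_isCoatom (he.primitive l) (he.primitive m) (fun h => hm ?_) hM f
    rw [he.basic l m h]
  exact fun h => hM.1 (top_unique (h ▸ hle))

lemma mul_idem_mem_stdKer {e : Λ → R} {l m : Λ} (hml : ¬ m ≤ l)
    (y : projMod e l) : e m • y ∈ stdKer e l := by
  refine Submodule.mem_iSup_of_mem m (Submodule.mem_iSup_of_mem hml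
    (Submodule.mem_iSup_of_mem (projMulRight e m y) ⟨projGen e m, rfl⟩))

/-- `Hom(P_m, Δ_l) = 0` unless `m ≤ l`. -/
lemma projHom_stdMod_eq_zero {e : Λ → R} {l m : Λ} (hml : ¬ m ≤ l)
    (hm : IsIdempotentElem (e m)) (f : projMod e m →ₗ[R] stdMod e l) : f = 0 := by
  ext x
  rw [projHom_apply hm f x, ← map_projGen hm f]
  obtain ⟨y, hy⟩ := (stdKer e l).mkQ_surjective (f (projGen e m))
  have h0 : (stdKer e l).mkQ (e m • y) = 0 :=
    (Submodule.Quotient.mk_eq_zero _).mpr (mul_idem_mem_stdKer hml y)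
  rw [← hy, ← map_smul, h0, smul_zero, LinearMap.zero_apply]

/-- If `e_m R e_l = 0` unless `m ≤ l`, then the indecomposable projectives are standard. -/
lemma stdKer_eq_bot {e : Λ → R} (he : ∀ l, IsIdempotentElem (e l))
    (h : ∀ l m, ¬ m ≤ l → ∀ x, e m * x * e l = 0) (l : Λ) : stdKer e l = ⊥ := by
  refine eq_bot_iff.mpr (iSup_le fun m => iSup_le fun hm => iSup_le fun f => ?_)
  rintro _ ⟨x, rfl⟩
  rw [Submodule.mem_bot, projHom_apply (he m) f x, ← map_projGen (he m) f]
  have : e m • f (projGen e m) = 0 := Subtype.ext (by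
    have h1 := h l m hm (f (projGen e m))
    rwa [mul_assoc, projMod_mul_idem (he l) (f (projGen e m)).2] at h1)
  rw [this, smul_zero]

/-- The kernels vanish, so filtrations of length `0` suffice. -/
lemma isStandardlyStratified_of_directed {e : Λ → R} (he : ∀ l, IsIdempotentElem (e l))
    (h : ∀ l m, ¬ m ≤ l → ∀ x, e m * x * e l = 0) : IsStandardlyStratified e :=
  fun l => ⟨0, fun _ => ⊥, rfl, (stdKer_eq_bot he h l).symm, fun _ hi => absurd hi (by simp)⟩

/-- The image of the generator of `P_m` lies in `e_m R e_l` and is nonzero. -/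
lemma le_of_projMod_equiv {e : Λ → R} (he : ∀ l, IsIdempotentElem (e l)) (he0 : ∀ l, e l ≠ 0)
    (h : ∀ l m, ¬ m ≤ l → ∀ x, e m * x * e l = 0) {l m : Λ}
    (f : projMod e m ≃ₗ[R] projMod e l) : m ≤ l := by
  by_contra hml
  have h1 := map_projGen (he m) f.toLinearMap
  have h2 : f (projGen e m) = 0 := by
    refine h1.symm.trans (Subtype.ext ?_)
    have h3 := h l m hml (f (projGen e m))
    rwa [mul_assoc, projMod_mul_idem (he l) (f (projGen e m)).2] at h3
  exact he0 m (congrArg Subtype.val ((LinearEquiv.map_eq_zero_iff f).mp h2))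

end Idempotents

/-! ### Koszul standard modules are the summands of `A_0`. -/

section KoszulStandard

variable {k : Type w} [Field k] {A : Type u} [Ring A] [Algebra k A] (𝒜 : ℕ → Submodule k A)
  [GradedAlgebra 𝒜]

lemma mem_posIdeal_iff {x : A} :
    x ∈ posIdeal 𝒜 ↔ GradedRing.projZeroRingHom 𝒜 x = 0 := Iff.rfl

lemma projZero_of_mem {x : A} (hx : x ∈ 𝒜 0) : GradedRing.projZeroRingHom 𝒜 x = x := by
  rw [GradedRing.projZeroRingHom_apply]
  exact DirectSum.decompose_of_mem_same 𝒜 hx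

lemma projZero_mem (x : A) : GradedRing.projZeroRingHom 𝒜 x ∈ 𝒜 0 := by
  rw [GradedRing.projZeroRingHom_apply]
  exact SetLike.coe_mem _

lemma mem_posIdeal_of_mem {x : A} {i : ℕ} (hi : i ≠ 0) (hx : x ∈ 𝒜 i) : x ∈ posIdeal 𝒜 := by
  rw [mem_posIdeal_iff, GradedRing.projZeroRingHom_apply]
  exact DirectSum.decompose_of_mem_ne 𝒜 hx hi

lemma sub_projZero_mem_posIdeal (x : A) :
    x - GradedRing.projZeroRingHom 𝒜 x ∈ posIdeal 𝒜 := by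
  rw [mem_posIdeal_iff, map_sub, projZero_of_mem 𝒜 (projZero_mem 𝒜 x), sub_self]

/-- In a graded module generated in degree `0`, the elements of degree `1` lie in `J P`, so that
every homomorphism to `A` takes them to `J`. -/
lemma map_degree_one_mem_posIdeal {P : Type u} [AddCommGroup P] [Module A P]
    {deg : ℤ → AddSubgroup P} (hgr : IsModuleGrading 𝒜 deg) (hgen : GeneratedInDegree A deg 0)
    (h : P →ₗ[A] A) {x : P} (hx : x ∈ deg 1) : h x ∈ posIdeal 𝒜 := by
  -- The map `h` need not respect degrees, so the remainder `j` carries two facts: it has no degree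
  -- `0` component, and `h j ∈ J`. When `y` has degree `1`, independence of the graded pieces forces
  -- `p = 0`.
  have key : ∀ y : P, ∃ p ∈ deg 0, ∃ j ∈ ⨆ i, ⨆ _ : i ≠ 0, deg i,
      h j ∈ posIdeal 𝒜 ∧ y = p + j := by
    have hadd : ∀ y z : P,
        (∃ p ∈ deg 0, ∃ j ∈ ⨆ i, ⨆ _ : i ≠ 0, deg i, h j ∈ posIdeal 𝒜 ∧ y = p + j) →
        (∃ p ∈ deg 0, ∃ j ∈ ⨆ i, ⨆ _ : i ≠ 0, deg i, h j ∈ posIdeal 𝒜 ∧ z = p + j) →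
        (∃ p ∈ deg 0, ∃ j ∈ ⨆ i, ⨆ _ : i ≠ 0, deg i, h j ∈ posIdeal 𝒜 ∧ y + z = p + j) := by
      rintro y z ⟨p, hp, j, hj, hj', rfl⟩ ⟨p', hp', j', hjj, hjj', rfl⟩
      exact ⟨p + p', add_mem hp hp', j + j', add_mem hj hjj,
        by rw [map_add]; exact add_mem hj' hjj', by abel⟩
    have hzero : ∃ p ∈ deg 0, ∃ j ∈ ⨆ i, ⨆ _ : i ≠ 0, deg i,
        h j ∈ posIdeal 𝒜 ∧ (0 : P) = p + j :=
      ⟨0, zero_mem _, 0, zero_mem _, by rw [map_zero]; exact zero_mem _, by simp⟩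
    intro y
    have hy : y ∈ Submodule.span A (deg 0 : Set P) := by rw [hgen]; trivial
    induction hy using Submodule.closure_induction with
    | zero => exact hzero
    | add y z _ _ hy hz => exact hadd y z hy hz
    | smul_mem a p hp =>
      induction a using DirectSum.Decomposition.inductionOn 𝒜 with
      | zero => rw [zero_smul]; exact hzero
      | add a b ha hb => rw [add_smul]; exact hadd _ _ ha hb
      | @homogeneous i a =>
        have hmem := hgr.smul_mem i 0 a p a.2 hp
        rw [add_zero] at hmem
        rcases eq_or_ne i 0 with rfl | hi
        · exact ⟨_, hmem, 0, zero_mem _, by rw [map_zero]; exact zero_mem _, by simp⟩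
        · refine ⟨0, zero_mem _, _, ?_, ?_, (zero_add _).symm⟩
          · exact AddSubgroup.mem_iSup_of_mem (i : ℤ)
              (AddSubgroup.mem_iSup_of_mem (by exact_mod_cast hi) hmem)
          · rw [map_smul, smul_eq_mul]
            exact posIdeal_mul_mem 𝒜 _ _ (mem_posIdeal_of_mem 𝒜 hi a.2)
  obtain ⟨p, hp, j, hj, hj', hxp⟩ := key x
  have hp' : p ∈ ⨆ i, ⨆ _ : i ≠ 0, deg i := by
    rw [show p = x - j by rw [hxp]; abel]
    exact sub_mem (AddSubgroup.mem_iSup_of_mem 1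
      (AddSubgroup.mem_iSup_of_mem one_ne_zero hx)) hj
  have hind := hgr.isInternal.addSubgroup_iSupIndep 0
  have hp0 : p = 0 := by
    have := hind.le_bot ⟨hp, hp'⟩
    simpa using this
  rw [hxp, hp0, zero_add]
  exact hj'

/-- If `ε : P 0 → M` is the start of a linear resolution, every homomorphism `P 0 → A` takes
the kernel of `ε` to `J`. -/
lemma IsKoszulModule.exists_projective_cover {M : Type u} [AddCommGroup M] [Module A M]
    {ℳ : ℤ → AddSubgroup M} (hM : IsKoszulModule 𝒜 ℳ) :
    ∃ (P : GrMod 𝒜) (ε : P.carrier →ₗ[A] M), Module.Projective A P.carrier ∧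
      Function.Surjective ε ∧
      ∀ (h : P.carrier →ₗ[A] A) (x : P.carrier), ε x = 0 → h x ∈ posIdeal 𝒜 := by
  obtain ⟨-, -, P, d, ε, hproj, hgen, hd, -, hsurj, hex, -⟩ := hM
  refine ⟨P 0, ε, hproj 0, hsurj, fun h x hx => ?_⟩
  obtain ⟨y, rfl⟩ := (hex x).mp hx
  have hy : y ∈ Submodule.span A ((P (0 + 1)).deg ((0 + 1 : ℕ) : ℤ) : Set _) := by
    rw [hgen 1]; trivial
  induction hy using Submodule.span_induction with
  | mem y hy => exact map_degree_one_mem_posIdeal 𝒜 (P 0).grading (hgen 0) h (hd 0 _ y hy)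
  | zero => rw [map_zero, map_zero]; exact zero_mem _
  | add y z _ _ hy hz =>
    rw [map_add, map_add]
    exact add_mem (hy (by rw [hex.apply_apply_eq_zero]) ) (hz (by rw [hex.apply_apply_eq_zero]))
  | smul a y _ hy =>
    rw [map_smul, map_smul]
    exact (posIdeal 𝒜).smul_mem a (hy (by rw [hex.apply_apply_eq_zero]))

variable {Λ : Type*} [PartialOrder Λ] {e : Λ → A}

/-- Each homogeneous component of `x` of positive degree maps to a positive degree of `Δ_l`, which
is zero. -/
lemma mem_stdKer_of_mem_posIdeal {l : Λ} (hl : IsIdempotentElem (e l)) (hl0 : e l ∈ 𝒜 0)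
    (hdeg : ConcentratedInDegree (stdDeg 𝒜 e l) 0) (x : projMod e l)
    (hx : (x : A) ∈ posIdeal 𝒜) : x ∈ stdKer e l := by
  classical
  rw [projMod_eq_smul_gen hl x]
  have hcomp : ∀ i, ((DirectSum.decompose 𝒜 (x : A) i : 𝒜 i) : A) • projGen e l ∈ stdKer e l := by
    intro i
    rcases eq_or_ne i 0 with rfl | hi
    · have : ((DirectSum.decompose 𝒜 (x : A) 0 : 𝒜 0) : A) = 0 := hx
      rw [this, zero_smul]; exact zero_mem _
    · have hmem : (stdKer e l).mkQ
          (((DirectSum.decompose 𝒜 (x : A) i : 𝒜 i) : A) • projGen e l) ∈ stdDeg 𝒜 e l i := by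
        refine ⟨_, ?_, rfl⟩
        have : ((DirectSum.decompose 𝒜 (x : A) i : 𝒜 i) : A) * e l ∈ 𝒜 (i + 0) :=
          SetLike.mul_mem_graded (SetLike.coe_mem _) hl0
        simpa [algDeg, projGen] using this
      rw [hdeg i (by exact_mod_cast hi)] at hmem
      exact (Submodule.Quotient.mk_eq_zero _).mp hmem
  rw [← DirectSum.sum_support_decompose 𝒜 (x : A), Finset.sum_smul]
  exact sum_mem fun i _ => hcomp i

/-- The Koszul half of the comparison: relations of the linear cover go to `J` under every map to
`A`, in particular under a lift of the cover to `P_l`. -/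
lemma mem_posIdeal_of_mem_stdKer {l : Λ} (hl : IsPrimitiveIdem (e l)) (hl0 : e l ∈ 𝒜 0)
    (hdeg : ConcentratedInDegree (stdDeg 𝒜 e l) 0) (hK : IsKoszulModule 𝒜 (stdDeg 𝒜 e l))
    (hne : stdKer e l ≠ ⊤) (x : projMod e l) (hx : x ∈ stdKer e l) : (x : A) ∈ posIdeal 𝒜 := by
  obtain ⟨P, ε, hproj, hsurj, hker⟩ := hK.exists_projective_cover 𝒜
  obtain ⟨h, hh⟩ := Module.projective_lifting_property (stdKer e l).mkQ ε
    (Submodule.mkQ_surjective _)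
  have hh' : ∀ y, (stdKer e l).mkQ (h y) = ε y := fun y => LinearMap.congr_fun hh y
  obtain ⟨p, hp⟩ := hsurj ((stdKer e l).mkQ (projGen e l))
  -- `f` is another representative of the generator of `Δ_l`, obtained through the linear cover. The
  -- factor `e l` puts it in `e_l A e_l`.
  set f : projMod e l := e l • h p with hf
  have hfe : (f : A) * e l = f := projMod_mul_idem hl.1 f.2
  have hef : e l * (f : A) = f := by
    rw [hf, Submodule.coe_smul, smul_eq_mul, ← mul_assoc, hl.1.eq]
  have hmk : (stdKer e l).mkQ f = (stdKer e l).mkQ (projGen e l) := by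
    rw [hf, map_smul, hh', hp]
    exact map_projGen hl.1 (stdKer e l).mkQ
  -- The element `y e_l p` lies in the kernel of `ε`, because `y` annihilates the class of the
  -- generator. The lift sends it to `y f`.
  have hmul : ∀ y : projMod e l, y ∈ stdKer e l → (y : A) * f ∈ posIdeal 𝒜 := by
    intro y hy
    have h1 := hker ((projMod e l).subtype.comp h) ((y : A) • e l • p) (by
      rw [map_smul, map_smul, hp, map_projGen hl.1 (stdKer e l).mkQ, ← projHom_apply hl.1]
      exact (Submodule.Quotient.mk_eq_zero _).mpr hy)
    simpa [hf] using h1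
  have hsub : projGen e l - f ∈ stdKer e l := by
    rw [← Submodule.Quotient.mk_eq_zero, ← Submodule.mkQ_apply, map_sub, hmk, sub_self]
  set φ := GradedRing.projZeroRingHom 𝒜
  have hφe : φ (e l) = e l := projZero_of_mem 𝒜 hl0
  have h1 : φ ((e l - f) * f) = 0 := hmul _ hsub
  -- As `e_l - f` lies in `stdKer`, `(e_l - f) f` lies in `J`, so `f` and `f f` agree in degree `0`.
  have hidem : φ f * φ f = φ f := by
    rw [sub_mul, hef, map_sub, map_mul, sub_eq_zero] at h1
    exact h1.symm
  have hef' : e l * φ f = φ f := by rw [← hφe, ← map_mul, hef]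
  have hfe' : φ f * e l = φ f := by rw [← hφe, ← map_mul, hfe]
  rcases hl.2.2 (φ f) (e l - φ f) hidem
      (by rw [IsIdempotentElem, sub_mul, mul_sub, mul_sub, hl.1.eq, hef', hfe', hidem]; abel)
      (by rw [mul_sub, hfe', hidem, sub_self]) (by rw [sub_mul, hef', hidem, sub_self])
      (by abel) with h0 | h0
  · exfalso
    apply hne
    have hfk : f ∈ stdKer e l := mem_stdKer_of_mem_posIdeal 𝒜 hl.1 hl0 hdeg f h0
    have hg : projGen e l ∈ stdKer e l := by simpa using add_mem hsub hfk
    rw [eq_top_iff]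
    intro y _
    rw [projMod_eq_smul_gen hl.1 y]
    exact Submodule.smul_mem _ _ hg
  -- Here `φ f = e_l`, so `φ x = φ (x e_l) = φ (x f)`, which is zero.
  · have h2 : φ (x * f) = 0 := hmul x hx
    change φ x = 0
    rw [← projMod_mul_idem hl.1 x.2, map_mul, hφe, sub_eq_zero.mp h0, ← map_mul, h2]

lemma mem_stdKer_iff [FiniteDimensional k A] [Fintype Λ] (he : IsBasicSystem e)
    (he0 : ∀ l, e l ∈ 𝒜 0) (hdeg : ∀ l, ConcentratedInDegree (stdDeg 𝒜 e l) 0)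
    (hK : ∀ l, IsKoszulModule 𝒜 (stdDeg 𝒜 e l)) {l : Λ} (x : projMod e l) :
    x ∈ stdKer e l ↔ (x : A) ∈ posIdeal 𝒜 := by
  have : IsArtinianRing A := IsArtinianRing.of_finite k A
  exact ⟨mem_posIdeal_of_mem_stdKer 𝒜 (he.primitive l) (he0 l) (hdeg l) (hK l)
    (stdKer_ne_top he l) x, mem_stdKer_of_mem_posIdeal 𝒜 (he.complete.idem l) (he0 l) (hdeg l) x⟩

/-- The inclusion `Δ_l → A_0`. -/
def stdIncl {l : Λ} (h : ∀ x : projMod e l, x ∈ stdKer e l ↔ (x : A) ∈ posIdeal 𝒜) :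
    stdMod e l →ₗ[A] degZeroMod 𝒜 :=
  Submodule.mapQ (stdKer e l) (posIdeal 𝒜) (projMod e l).subtype fun x hx => (h x).mp hx

/-- The projection `A_0 → Δ_l`, `x ↦ x e_l`. -/
def stdProj {l : Λ} (h : ∀ x : projMod e l, x ∈ stdKer e l ↔ (x : A) ∈ posIdeal 𝒜) :
    degZeroMod 𝒜 →ₗ[A] stdMod e l :=
  Submodule.mapQ (posIdeal 𝒜) (stdKer e l) (LinearMap.toSpanSingleton A _ (projGen e l))
    fun x hx => (h _).mpr (posIdeal_mul_mem 𝒜 (e l) x hx)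

/-- This factorisation of `ε_l` through `Δ_l` is what transfers Ext groups between `A_0` and the
standard modules. -/
lemma stdIncl_comp_stdProj {l : Λ}
    (h : ∀ x : projMod e l, x ∈ stdKer e l ↔ (x : A) ∈ posIdeal 𝒜) :
    (stdIncl 𝒜 h).comp (stdProj 𝒜 h) = rightMul 𝒜 (e l) := by
  refine Submodule.linearMap_qext _ ?_
  ext
  rfl

lemma stdProj_stdIncl_self {l : Λ} (hl : IsIdempotentElem (e l))
    (h : ∀ x : projMod e l, x ∈ stdKer e l ↔ (x : A) ∈ posIdeal 𝒜) (x : stdMod e l) :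
    stdProj 𝒜 h (stdIncl 𝒜 h x) = x := by
  obtain ⟨y, rfl⟩ := (stdKer e l).mkQ_surjective x
  change (stdKer e l).mkQ ((y : A) • projGen e l) = _
  rw [← projMod_eq_smul_gen hl]

lemma stdProj_stdIncl_of_ne [Fintype Λ] (he : CompleteOrthogonalIdempotents e)
    (h : ∀ l, ∀ x : projMod e l, x ∈ stdKer e l ↔ (x : A) ∈ posIdeal 𝒜) {l m : Λ}
    (hlm : l ≠ m) (x : stdMod e l) : stdProj 𝒜 (h m) (stdIncl 𝒜 (h l) x) = 0 := by
  obtain ⟨y, rfl⟩ := (stdKer e l).mkQ_surjective x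
  change (stdKer e m).mkQ ((y : A) • projGen e m) = _
  have : (y : A) • projGen e m = 0 := by
    apply Subtype.ext
    change (y : A) * e m = 0
    rw [← projMod_mul_idem (he.idem l) y.2, mul_assoc, he.ortho hlm, mul_zero]
  rw [this, map_zero]

lemma sum_rightMul {ι : Type*} [Fintype ι] {e : ι → A} (he : CompleteOrthogonalIdempotents e) :
    ∑ l, rightMul 𝒜 (e l) = LinearMap.id := by
  refine Submodule.linearMap_qext _ ?_
  ext
  simp only [LinearMap.comp_apply, LinearMap.sum_apply]
  change ∑ l, (posIdeal 𝒜).mkQ ((1 : A) * e l) = (posIdeal 𝒜).mkQ 1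
  rw [← map_sum, ← Finset.mul_sum, he.complete, mul_one]

lemma degZeroMod_equiv [Fintype Λ] (he : CompleteOrthogonalIdempotents e)
    (h : ∀ l, ∀ x : projMod e l, x ∈ stdKer e l ↔ (x : A) ∈ posIdeal 𝒜) :
    Nonempty (degZeroMod 𝒜 ≃ₗ[A] ⨁ l, stdMod e l) := by
  classical
  let F : degZeroMod 𝒜 →ₗ[A] ⨁ l, stdMod e l :=
    ∑ l, (DirectSum.lof A Λ (fun l => stdMod e l) l).comp (stdProj 𝒜 (h l))
  let G : (⨁ l, stdMod e l) →ₗ[A] degZeroMod 𝒜 :=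
    DirectSum.toModule A Λ _ fun l => stdIncl 𝒜 (h l)
  refine ⟨LinearEquiv.ofLinearMap F G ?_ ?_⟩
  · refine DirectSum.linearMap_ext _ fun l => LinearMap.ext fun x => ?_
    simp only [F, G, LinearMap.comp_apply, LinearMap.sum_apply, DirectSum.toModule_lof,
      LinearMap.id_apply]
    rw [Finset.sum_eq_single l]
    · rw [stdProj_stdIncl_self 𝒜 (he.idem l)]
    · intro m _ hm
      rw [stdProj_stdIncl_of_ne 𝒜 he h hm.symm, map_zero]
    · simp
  · rw [← sum_rightMul 𝒜 he]
    refine LinearMap.ext fun x => ?_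
    simp only [F, G, LinearMap.comp_apply, LinearMap.sum_apply, map_sum, DirectSum.toModule_lof,
      ← stdIncl_comp_stdProj 𝒜 (h _)]

end KoszulStandard

/-! ### Descending induction along the stratification; vanishing of Ext. -/

section ShortExact

variable {A : Type u} [Ring A]

/-- A short exact sequence of modules as a short complex in the module category. -/
lemma exists_shortExact {M N P : Type u} [AddCommGroup M] [Module A M] [AddCommGroup N]
    [Module A N] [AddCommGroup P] [Module A P] (f : M →ₗ[A] N) (g : N →ₗ[A] P)
    (hf : Function.Injective f) (hg : Function.Surjective g) (hfg : Function.Exact f g) :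
    (ShortComplex.mk (ModuleCat.ofHom f) (ModuleCat.ofHom g)
      (by ext x; exact hfg.apply_apply_eq_zero x)).ShortExact := by
  have : Mono (ModuleCat.ofHom f) := (ModuleCat.mono_iff_injective _).mpr hf
  have : Epi (ModuleCat.ofHom g) := (ModuleCat.epi_iff_surjective _).mpr hg
  refine ShortComplex.ShortExact.mk ?_
  rw [ShortComplex.ShortExact.moduleCat_exact_iff_function_exact]
  exact hfg

variable {Λ : Type*} [PartialOrder Λ] {e : Λ → A}

/-- Over a standardly stratified ring, a property of modules that holds for zero modules, is
closed under extensions, and passes from the kernel of `P_m → Δ_m` to `Δ_m` for all `m ≥ l`,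
holds for `Δ_l`. -/
lemma IsStandardlyStratified.stdMod_induction [Finite Λ] (hs : IsStandardlyStratified e)
    (Q : ModuleCat.{u} A → Prop) (hzero : ∀ X : ModuleCat.{u} A, Limits.IsZero X → Q X)
    (hext : ∀ S : ShortComplex (ModuleCat.{u} A), S.ShortExact → Q S.X₁ → Q S.X₃ → Q S.X₂)
    (l : Λ)
    (hstd : ∀ m, l ≤ m → ∀ S : ShortComplex (ModuleCat.{u} A), S.ShortExact →
      S.X₂ = ModuleCat.of A (projMod e m) → Q S.X₁ →
      S.X₃ = ModuleCat.of A (stdMod e m) → Q S.X₃) :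
    Q (ModuleCat.of A (stdMod e l)) := by
  -- The factors of the kernel have strictly larger index, so they are settled first and the kernel
  -- is assembled from them by extensions.
  induction l using WellFoundedGT.induction with
  | _ l ih =>
  have hker : Q (ModuleCat.of A (stdKer e l)) := by
    obtain ⟨n, F, h0, hn, hF⟩ := hs l
    have hQ : ∀ i ≤ n, Q (ModuleCat.of A (F i)) := by
      intro i
      induction i with
      | zero =>
        intro _
        rw [h0]
        exact hzero _ (ModuleCat.isZero_of_subsingleton _)
      | succ i IH =>
        intro hi
        obtain ⟨hle, m, hlm, ⟨φ⟩⟩ := hF i hi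
        refine hext _ (exists_shortExact (Submodule.inclusion hle)
          (φ.toLinearMap.comp (Submodule.mkQ _)) (Submodule.inclusion_injective hle)
          (φ.surjective.comp (Submodule.mkQ_surjective _)) ?_) (IH (by omega))
          (ih m hlm fun m' hm' => hstd m' (hlm.le.trans hm'))
        intro x
        rw [LinearMap.comp_apply, LinearEquiv.coe_coe, LinearEquiv.map_eq_zero_iff,
          Submodule.mkQ_apply, Submodule.Quotient.mk_eq_zero, Submodule.submoduleOf,
          Submodule.mem_comap]
        exact ⟨fun hx => ⟨⟨x, hx⟩, rfl⟩, by rintro ⟨y, rfl⟩; exact y.2⟩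
    rw [← hn]
    exact hQ n le_rfl
  exact hstd l le_rfl _ (exists_shortExact (stdKer e l).subtype (stdKer e l).mkQ
    (Submodule.subtype_injective _) (Submodule.mkQ_surjective _)
    (LinearMap.exact_subtype_mkQ _)) rfl hker rfl

/-- The standard modules of a standardly stratified ring have finite projective dimension. -/
lemma IsStandardlyStratified.exists_hasProjectiveDimensionLT [Finite Λ]
    (hs : IsStandardlyStratified e) (he : ∀ l, IsIdempotentElem (e l)) (l : Λ) :
    ∃ n, HasProjectiveDimensionLT (ModuleCat.of A (stdMod e l)) n := by
  refine hs.stdMod_induction (fun X => ∃ n, HasProjectiveDimensionLT X n)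
    (fun X hX => ⟨0, hX.hasProjectiveDimensionLT_zero⟩) ?_ l ?_
  · rintro S hS ⟨n, hn⟩ ⟨m, hm⟩
    exact ⟨max n m, hS.hasProjectiveDimensionLT_X₂ _
      (hasProjectiveDimensionLT_of_ge _ n _ (le_max_left _ _))
      (hasProjectiveDimensionLT_of_ge _ m _ (le_max_right _ _))⟩
  · rintro m - S hS h2 ⟨n, hn⟩ -
    have := projMod_projective (he m)
    have hproj : Projective S.X₂ := by rw [h2]; infer_instance
    exact ⟨n + 1, hS.hasProjectiveDimensionLT_X₃ n hn
      (hasProjectiveDimensionLT_of_ge _ 1 _ (by omega))⟩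

/-- `Ext^n(Δ_l, Δ_m) = 0` unless `l ≤ m`. -/
lemma IsStandardlyStratified.subsingleton_ext [Finite Λ]
    (hs : IsStandardlyStratified e) (he : ∀ l, IsIdempotentElem (e l)) {l m : Λ}
    (hlm : ¬ l ≤ m) (n : ℕ) :
    Subsingleton (Abelian.Ext.{u} (ModuleCat.of A (stdMod e l))
      (ModuleCat.of A (stdMod e m)) n) := by
  set Y := ModuleCat.of A (stdMod e m) with hY
  -- All degrees are treated together because the connecting map relates `Ext^(n+1)` of `Δ` to
  -- `Ext^n` of the kernel.
  refine hs.stdMod_induction (fun X => ∀ n, Subsingleton (Abelian.Ext.{u} X Y n))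
    (fun X hX n => ?_) (fun S hS h1 h3 n => ?_) l (fun m' hm' S hS h2 h1 _ n => ?_) n
  · have := hX.hasProjectiveDimensionLT_zero
    exact HasProjectiveDimensionLT.subsingleton X 0 n (Nat.zero_le _) Y
  · refine subsingleton_of_forall_eq 0 fun x => ?_
    obtain ⟨y, rfl⟩ := Abelian.Ext.contravariant_sequence_exact₂ hS Y x
      ((h1 n).elim _ _)
    rw [(h3 n).elim y 0, Abelian.Ext.comp_zero]
  · refine subsingleton_of_forall_eq 0 fun x => ?_
    have hproj : Projective S.X₂ := by
      have := projMod_projective (he m')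
      rw [h2]; infer_instance
    cases n with
    | zero =>
      have := hS.epi_g
      obtain ⟨f, rfl⟩ := (Abelian.Ext.mk₀_bijective _ _).2 x
      -- From `l ≤ m'` and `l ≰ m` follows `m' ≰ m`. The object `Z` is a variable so that the
      -- equality describing `S.X₂` can be substituted.
      have hz : ∀ (Z : ModuleCat.{u} A), Z = ModuleCat.of A (projMod e m') →
          ∀ g : Z ⟶ Y, g = 0 := by
        rintro _ rfl g
        ext1
        exact projHom_stdMod_eq_zero (fun h => hlm (hm'.trans h)) (he m') g.hom
      have hf : f = 0 := by
        rw [← cancel_epi S.g, Limits.comp_zero]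
        exact hz _ h2 _
      rw [hf, Abelian.Ext.mk₀_zero]
    | succ n =>
      obtain ⟨y, rfl⟩ := Abelian.Ext.contravariant_sequence_exact₃ hS Y x
        (Abelian.Ext.eq_zero_of_projective _) (add_comm 1 n)
      rw [(h1 n).elim y 0, Abelian.Ext.comp_zero]

end ShortExact

/-! ### Finite-dimensionality of Ext. -/

section Finiteness

variable {k : Type w} [Field k] {A : Type u} [Ring A] [Algebra k A]
  {Λ : Type*} [PartialOrder Λ] {e : Λ → A}

lemma finite_of_exact {V₁ V₂ V₃ : Type*} [AddCommGroup V₁] [Module k V₁] [AddCommGroup V₂]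
    [Module k V₂] [AddCommGroup V₃] [Module k V₃] [Module.Finite k V₁] [Module.Finite k V₃]
    (f : V₁ →ₗ[k] V₂) (g : V₂ →ₗ[k] V₃) (h : ∀ x, g x = 0 → ∃ y, f y = x) :
    Module.Finite k V₂ := by
  have h1 : Module.Finite k (LinearMap.ker g) :=
    Submodule.finiteDimensional_of_le (S₂ := LinearMap.range f) fun x hx => h x hx
  have h2 : Module.Finite k (V₂ ⧸ LinearMap.ker g) :=
    Module.Finite.equiv g.quotKerEquivRange.symm
  exact Module.Finite.of_submodule_quotient (LinearMap.ker g)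

open scoped ModuleCat in
-- Evaluation at the generator embeds `Hom(A e_l, Y)` in `Y`.
lemma finite_ext_zero_of_projMod {ι : Type*} {e : ι → A} [FiniteDimensional k A] {l : ι}
    (hl : IsIdempotentElem (e l))
    (Y : ModuleCat.{u} A) [Module.Finite A Y] :
    Module.Finite k (Abelian.Ext.{u} (ModuleCat.of A (projMod e l)) Y 0) := by
  have : Module.Finite k Y := Module.Finite.trans A Y
  let ev : (ModuleCat.of A (projMod e l) ⟶ Y) →ₗ[k] Y :=
    { toFun := fun f => f.hom (projGen e l)
      map_add' := fun _ _ => rfl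
      map_smul' := fun _ _ => rfl }
  refine Module.Finite.of_injective
    (ev ∘ₗ (Abelian.Ext.linearEquiv₀ (R := k)).toLinearMap) ?_
  rw [LinearMap.coe_comp, LinearEquiv.coe_coe]
  refine Function.Injective.comp (fun f g hfg => ?_)
    (Abelian.Ext.linearEquiv₀ (R := k)).injective
  ext1
  ext1 x
  rw [projHom_apply hl, projHom_apply hl g.hom]
  exact congrArg _ hfg

/-- `Ext^n(Δ_l, Y)` is finite-dimensional for every finitely generated module `Y`. -/
lemma IsStandardlyStratified.finite_ext [Finite Λ] [FiniteDimensional k A]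
    (hs : IsStandardlyStratified e) (he : ∀ l, IsIdempotentElem (e l))
    (Y : ModuleCat.{u} A) [Module.Finite A Y] (l : Λ) (n : ℕ) :
    Module.Finite k (Abelian.Ext.{u} (ModuleCat.of A (stdMod e l)) Y n) := by
  refine hs.stdMod_induction (fun X => ∀ n, Module.Finite k (Abelian.Ext.{u} X Y n))
    (fun X hX n => ?_) (fun S hS h1 h3 n => ?_) l (fun m' hm' S hS h2 h1 _ n => ?_) n
  · have := hX.hasProjectiveDimensionLT_zero
    have := HasProjectiveDimensionLT.subsingleton X 0 n (Nat.zero_le _) Y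
    infer_instance
  · have := h1 n
    have := h3 n
    exact finite_of_exact
      ((Abelian.Ext.mk₀ S.g).precompOfLinear k Y (zero_add n))
      ((Abelian.Ext.mk₀ S.f).precompOfLinear k Y (zero_add n))
      fun x hx => Abelian.Ext.contravariant_sequence_exact₂ hS Y x hx
  · have hproj : Projective S.X₂ := by
      have := projMod_projective (he m')
      rw [h2]; infer_instance
    cases n with
    | zero =>
      have := hS.epi_g
      have : Module.Finite k (Abelian.Ext.{u} S.X₂ Y 0) := by
        rw [h2]; exact finite_ext_zero_of_projMod (he m') Y
      refine Module.Finite.of_injective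
        ((Abelian.Ext.mk₀ S.g).precompOfLinear k Y (zero_add 0)) ?_
      refine (injective_iff_map_eq_zero _).mpr fun x hx => ?_
      obtain ⟨f, rfl⟩ := (Abelian.Ext.mk₀_bijective _ _).2 x
      have hx' : (Abelian.Ext.mk₀ S.g).comp (Abelian.Ext.mk₀ f) (zero_add 0) = 0 := hx
      rw [Abelian.Ext.mk₀_comp_mk₀, Abelian.Ext.mk₀_eq_zero_iff] at hx'
      rw [Abelian.Ext.mk₀_eq_zero_iff, ← cancel_epi S.g, hx', Limits.comp_zero]
    | succ n =>
      have := h1 n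
      exact Module.Finite.of_surjective
        (hS.extClass.precompOfLinear k Y (add_comm 1 n)) fun x =>
          Abelian.Ext.contravariant_sequence_exact₃ hS Y x
            (Abelian.Ext.eq_zero_of_projective _) (add_comm 1 n)

end Finiteness

/-! ### Idempotents in graded rings. -/

section GradedIdempotents

/-- An idempotent of an `ℕ`-graded ring without degree `0` component is zero. -/
lemma DirectSum.eq_zero_of_isIdempotentElem {B : ℕ → Type*} [∀ n, AddCommMonoid (B n)]
    [GSemiring B] {f : ⨁ n, B n} (hf : IsIdempotentElem f) (h0 : f 0 = 0) : f = 0 := by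
  classical
  -- If `f` vanishes in degrees up to `n`, the products of its components that make up `f * f` start
  -- in degree `2n + 2`, beyond `n + 1`.
  have key : ∀ n, ∀ i < n + 1, f i = 0 := by
    intro n
    induction n with
    | zero => intro i hi; obtain rfl : i = 0 := by omega
              exact h0
    | succ n ih =>
      intro i hi
      rw [← hf.eq, DirectSum.mul_eq_sum_support_ghas_mul, DFinsupp.finsetSum_apply]
      refine Finset.sum_eq_zero fun p hp => ?_
      rw [Finset.mem_product, DFinsupp.mem_support_iff, DFinsupp.mem_support_iff] at hp
      refine DirectSum.of_eq_of_ne _ _ _ fun hpi => ?_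
      have h1 : ¬ p.1 < n + 1 := fun h => hp.1 (ih _ h)
      have h2 : ¬ p.2 < n + 1 := fun h => hp.2 (ih _ h)
      omega
  ext i
  rw [key i i (Nat.lt_succ_self i), DirectSum.zero_apply]

end GradedIdempotents

/-! ### Multiplication in the Yoneda algebra. -/

section YonedaAlgebra

variable {C : Type*} [Category C] [Abelian C] [HasExt.{u} C]

lemma yoneda_of_mul_of (X : C) {n m : ℕ} (x : Abelian.Ext.{u} X X n)
    (y : Abelian.Ext.{u} X X m) :
    (DirectSum.of (fun n : ℕ => Abelian.Ext.{u} X X n) n x) *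
      DirectSum.of (fun n : ℕ => Abelian.Ext.{u} X X n) m y =
    DirectSum.of (fun n : ℕ => Abelian.Ext.{u} X X n) (n + m) (y.comp x (add_comm m n)) :=
  DirectSum.of_mul_of _ _

/-- As degrees are non-negative, only the degree `0` components contribute. Idempotent relations in
`Γ` thus descend to `Ext^0`. -/
lemma yoneda_mul_zero_apply (X : C) (x y : YonedaAlgebra.{u} X) :
    (x * y) 0 = (y 0).comp (x 0) (add_zero 0) := by
  induction x using DirectSum.induction_on with
  | zero => simp
  | add x x' hx hx' => simp only [add_mul, DirectSum.add_apply, hx, hx', Abelian.Ext.comp_add]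
  | of n x =>
    induction y using DirectSum.induction_on with
    | zero => simp
    | add y y' hy hy' => simp only [mul_add, DirectSum.add_apply, hy, hy', Abelian.Ext.add_comp]
    | of m y =>
      rw [yoneda_of_mul_of]
      rcases eq_or_ne n 0 with rfl | hn
      · rcases eq_or_ne m 0 with rfl | hm
        · rw [DirectSum.of_eq_same, DirectSum.of_eq_same]
          exact DirectSum.of_eq_same (β := fun n : ℕ => Abelian.Ext.{u} X X n) 0 _
        · rw [DirectSum.of_eq_of_ne _ _ _ (by omega), DirectSum.of_eq_of_ne m 0 y (by omega),
            Abelian.Ext.zero_comp]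
      · rw [DirectSum.of_eq_of_ne _ _ _ (by omega), DirectSum.of_eq_of_ne n 0 x (by omega),
          Abelian.Ext.comp_zero]

end YonedaAlgebra

/-! ### The idempotents and the dimension of `Γ`. -/

section Dual

variable {k : Type w} [Field k] {A : Type u} [Ring A] [Algebra k A] (𝒜 : ℕ → Submodule k A)
  [GradedAlgebra 𝒜]

@[simp]
lemma rightMul_mk (a b : A) :
    rightMul 𝒜 a ((posIdeal 𝒜).mkQ b) = (posIdeal 𝒜).mkQ (b * a) := rfl

lemma rightMul_comp (a b : A) : (rightMul 𝒜 a).comp (rightMul 𝒜 b) = rightMul 𝒜 (b * a) := by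
  refine LinearMap.ext fun x => ?_
  obtain ⟨c, rfl⟩ := (posIdeal 𝒜).mkQ_surjective x
  rw [LinearMap.comp_apply, rightMul_mk, rightMul_mk, rightMul_mk, mul_assoc]

lemma rightMul_add (a b : A) : rightMul 𝒜 (a + b) = rightMul 𝒜 a + rightMul 𝒜 b := by
  refine LinearMap.ext fun x => ?_
  obtain ⟨c, rfl⟩ := (posIdeal 𝒜).mkQ_surjective x
  rw [LinearMap.add_apply, rightMul_mk, rightMul_mk, rightMul_mk, mul_add, map_add]

lemma rightMul_injOn {a b : A} (ha : a ∈ 𝒜 0) (hb : b ∈ 𝒜 0)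
    (h : rightMul 𝒜 a = rightMul 𝒜 b) : a = b := by
  have h1 := LinearMap.congr_fun h ((posIdeal 𝒜).mkQ 1)
  rw [rightMul_mk, rightMul_mk, one_mul, one_mul, ← sub_eq_zero, ← map_sub] at h1
  have h2 : a - b ∈ posIdeal 𝒜 := (Submodule.Quotient.mk_eq_zero _).mp h1
  rw [mem_posIdeal_iff, projZero_of_mem 𝒜 (sub_mem ha hb)] at h2
  exact sub_eq_zero.mp h2

/-- An endomorphism of the cyclic module `A / J` is determined by the image of `1`, which has a
representative in `A_0`. -/
lemma exists_eq_rightMul (φ : degZeroMod 𝒜 →ₗ[A] degZeroMod 𝒜) :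
    ∃ a ∈ 𝒜 0, φ = rightMul 𝒜 a := by
  obtain ⟨b, hb⟩ := (posIdeal 𝒜).mkQ_surjective (φ ((posIdeal 𝒜).mkQ 1))
  refine ⟨_, projZero_mem 𝒜 b, Submodule.linearMap_qext _ ?_⟩
  ext
  simp only [LinearMap.comp_apply]
  rw [← hb, rightMul_mk, one_mul, ← sub_eq_zero, ← map_sub]
  exact (Submodule.Quotient.mk_eq_zero _).mpr (sub_projZero_mem_posIdeal 𝒜 b)

/-- The element of `Ext^0(A_0, A_0)` given by right multiplication. -/
noncomputable abbrev extRightMul (a : A) : Abelian.Ext.{u} (ModuleCat.of A (degZeroMod 𝒜))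
    (ModuleCat.of A (degZeroMod 𝒜)) 0 :=
  Abelian.Ext.mk₀ (ModuleCat.ofHom (rightMul 𝒜 a))

lemma extRightMul_comp (a b : A) :
    (extRightMul 𝒜 a).comp (extRightMul 𝒜 b) (add_zero 0) = extRightMul 𝒜 (a * b) := by
  rw [Abelian.Ext.mk₀_comp_mk₀, ← ModuleCat.ofHom_comp, rightMul_comp]

lemma extRightMul_add (a b : A) :
    extRightMul 𝒜 (a + b) = extRightMul 𝒜 a + extRightMul 𝒜 b := by
  rw [extRightMul, rightMul_add, ModuleCat.ofHom_add, Abelian.Ext.mk₀_add]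

lemma extRightMul_zero : extRightMul 𝒜 (0 : A) = 0 := by
  simpa using extRightMul_add 𝒜 0 0

lemma extRightMul_injOn {a b : A} (ha : a ∈ 𝒜 0) (hb : b ∈ 𝒜 0)
    (h : extRightMul 𝒜 a = extRightMul 𝒜 b) : a = b :=
  rightMul_injOn 𝒜 ha hb (congrArg ModuleCat.Hom.hom ((Abelian.Ext.mk₀_bijective _ _).1 h))

lemma exists_eq_extRightMul (x : Abelian.Ext.{u} (ModuleCat.of A (degZeroMod 𝒜))
    (ModuleCat.of A (degZeroMod 𝒜)) 0) : ∃ a ∈ 𝒜 0, x = extRightMul 𝒜 a := by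
  obtain ⟨φ, rfl⟩ := (Abelian.Ext.mk₀_bijective _ _).2 x
  obtain ⟨a, ha, h⟩ := exists_eq_rightMul 𝒜 φ.hom
  exact ⟨a, ha, by rw [extRightMul, ← h]; rfl⟩

lemma dualIdem_apply_zero (a : A) : dualIdem 𝒜 a 0 = extRightMul 𝒜 a :=
  DirectSum.of_eq_same _ _

lemma dualIdem_mul (a b : A) : dualIdem 𝒜 a * dualIdem 𝒜 b = dualIdem 𝒜 (b * a) := by
  rw [dualIdem, dualIdem, yoneda_of_mul_of]
  exact congrArg _ (extRightMul_comp 𝒜 b a)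

lemma dualIdem_zero : dualIdem 𝒜 0 = 0 := by
  rw [dualIdem]
  exact (congrArg _ (extRightMul_zero 𝒜)).trans (map_zero _)

/-- A primitive idempotent of `A` in degree `0` gives a primitive idempotent of `Γ`. -/
lemma IsPrimitiveIdem.dualIdem {a : A} (ha : IsPrimitiveIdem a) (ha0 : a ∈ 𝒜 0) :
    IsPrimitiveIdem (dualIdem 𝒜 a) := by
  refine ⟨by rw [IsIdempotentElem, dualIdem_mul, ha.1.eq], fun h => ha.2.1 ?_, ?_⟩
  · refine extRightMul_injOn 𝒜 ha0 (zero_mem _) ?_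
    rw [← dualIdem_apply_zero, h, extRightMul_zero, DirectSum.zero_apply]
  · intro f g hf hg hfg hgf hsum
    obtain ⟨b, hb, hfb⟩ := exists_eq_extRightMul 𝒜 (f 0)
    obtain ⟨c, hc, hgc⟩ := exists_eq_extRightMul 𝒜 (g 0)
    have hmul : ∀ {p q : A}, p ∈ 𝒜 0 → q ∈ 𝒜 0 → p * q ∈ 𝒜 0 := fun hp hq => by
      have := SetLike.mul_mem_graded hp hq
      rwa [add_zero] at this
    have h1 : b * b = b := extRightMul_injOn 𝒜 (hmul hb hb) hb (by
      rw [← extRightMul_comp, ← hfb, ← yoneda_mul_zero_apply, hf.eq])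
    have h2 : c * c = c := extRightMul_injOn 𝒜 (hmul hc hc) hc (by
      rw [← extRightMul_comp, ← hgc, ← yoneda_mul_zero_apply, hg.eq])
    -- The order of the factors is reversed: `b * c` is governed by `g * f`.
    have h3 : b * c = 0 := extRightMul_injOn 𝒜 (hmul hb hc) (zero_mem _) (by
      rw [← extRightMul_comp, ← hfb, ← hgc, ← yoneda_mul_zero_apply, hgf, extRightMul_zero,
        DirectSum.zero_apply])
    have h4 : c * b = 0 := extRightMul_injOn 𝒜 (hmul hc hb) (zero_mem _) (by
      rw [← extRightMul_comp, ← hfb, ← hgc, ← yoneda_mul_zero_apply, hfg, extRightMul_zero,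
        DirectSum.zero_apply])
    have h5 : b + c = a := extRightMul_injOn 𝒜 (add_mem hb hc) ha0 (by
      rw [extRightMul_add, ← hfb, ← hgc, ← DirectSum.add_apply, hsum, dualIdem_apply_zero])
    rcases ha.2.2 b c h1 h2 h3 h4 h5 with h | h
    · exact Or.inl (DirectSum.eq_zero_of_isIdempotentElem hf
        (by rw [hfb, h, extRightMul_zero]))
    · exact Or.inr (DirectSum.eq_zero_of_isIdempotentElem hg
        (by rw [hgc, h, extRightMul_zero]))

lemma sum_extRightMul {Λ : Type*} [Fintype Λ] {e : Λ → A} (he : CompleteOrthogonalIdempotents e) :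
    ∑ l, extRightMul 𝒜 (e l) = Abelian.Ext.mk₀ (𝟙 (ModuleCat.of A (degZeroMod 𝒜))) := by
  rw [← Abelian.Ext.mk₀_sum]
  congr 1
  ext1
  rw [ModuleCat.hom_sum]
  exact sum_rightMul 𝒜 he

lemma completeOrthogonalIdempotents_dualIdem {Λ : Type*} [Fintype Λ] {e : Λ → A}
    (he : CompleteOrthogonalIdempotents e) :
    CompleteOrthogonalIdempotents fun l => dualIdem 𝒜 (e l) where
  idem l := by rw [IsIdempotentElem, dualIdem_mul, (he.idem l).eq]
  ortho l m hlm := by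
    change dualIdem 𝒜 (e l) * dualIdem 𝒜 (e m) = 0
    rw [dualIdem_mul, he.ortho hlm.symm, dualIdem_zero]
  complete := by
    simp only [dualIdem]
    rw [← map_sum]
    exact congrArg _ (sum_extRightMul 𝒜 he)

variable {Λ : Type*} [PartialOrder Λ] {e : Λ → A}

lemma extRightMul_eq {l : Λ} (h : ∀ x : projMod e l, x ∈ stdKer e l ↔ (x : A) ∈ posIdeal 𝒜) :
    extRightMul 𝒜 (e l) = (Abelian.Ext.mk₀ (ModuleCat.ofHom (stdProj 𝒜 h))).comp
      (Abelian.Ext.mk₀ (ModuleCat.ofHom (stdIncl 𝒜 h))) (add_zero 0) := by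
  rw [Abelian.Ext.mk₀_comp_mk₀, ← ModuleCat.ofHom_comp, stdIncl_comp_stdProj]

/-- `ε_m Γ ε_l = 0` unless `l ≤ m`. -/
lemma dualIdem_mul_mul_dualIdem_eq_zero [Finite Λ] (hs : IsStandardlyStratified e)
    (he : ∀ l, IsIdempotentElem (e l))
    (h : ∀ l, ∀ x : projMod e l, x ∈ stdKer e l ↔ (x : A) ∈ posIdeal 𝒜) {l m : Λ}
    (hlm : ¬ l ≤ m) (x : KoszulDual 𝒜) : dualIdem 𝒜 (e m) * x * dualIdem 𝒜 (e l) = 0 := by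
  induction x using DirectSum.induction_on with
  | zero => simp
  | add x y hx hy => rw [mul_add, add_mul, hx, hy, add_zero]
  | of n x =>
    rw [dualIdem, dualIdem, yoneda_of_mul_of, yoneda_of_mul_of]
    have := hs.subsingleton_ext he hlm (0 + n)
    refine (congrArg _ ?_).trans (map_zero _)
    change (extRightMul 𝒜 (e l)).comp (x.comp (extRightMul 𝒜 (e m)) _) _ = 0
    rw [extRightMul_eq 𝒜 (h l), extRightMul_eq 𝒜 (h m)]
    have hz : (Abelian.Ext.mk₀ (ModuleCat.ofHom (stdIncl 𝒜 (h l)))).comp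
        (x.comp (Abelian.Ext.mk₀ (ModuleCat.ofHom (stdProj 𝒜 (h m)))) (add_comm n 0))
        (zero_add (0 + n)) = 0 := Subsingleton.elim _ _
    rw [← Abelian.Ext.comp_assoc x (Abelian.Ext.mk₀ (ModuleCat.ofHom (stdProj 𝒜 (h m))))
        (Abelian.Ext.mk₀ (ModuleCat.ofHom (stdIncl 𝒜 (h m)))) (add_comm n 0) (add_zero 0) (by omega),
      Abelian.Ext.comp_assoc_of_second_deg_zero, ← Abelian.Ext.comp_assoc_of_third_deg_zero, hz,
      Abelian.Ext.zero_comp, Abelian.Ext.comp_zero]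

/-- The identity of `A_0` is the sum of the `ε_l`, each factoring through `Δ_l`, so a class is
recovered from its restrictions to the `Δ_l`. -/
lemma injective_precomp_stdIncl [Fintype Λ] (he : CompleteOrthogonalIdempotents e)
    (h : ∀ l, ∀ x : projMod e l, x ∈ stdKer e l ↔ (x : A) ∈ posIdeal 𝒜)
    (Y : ModuleCat.{u} A) (n : ℕ) :
    Function.Injective (LinearMap.pi fun l : Λ =>
      (Abelian.Ext.mk₀ (ModuleCat.ofHom (stdIncl 𝒜 (h l)))).precompOfLinear k Y (zero_add n)) := by
  refine (injective_iff_map_eq_zero _).mpr fun x hx => ?_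
  have hx' : ∀ l, (Abelian.Ext.mk₀ (ModuleCat.ofHom (stdIncl 𝒜 (h l)))).comp x (zero_add n) = 0 :=
    fun l => congrFun hx l
  rw [← Abelian.Ext.mk₀_id_comp x, ← sum_extRightMul 𝒜 he, Abelian.Ext.sum_comp]
  refine Finset.sum_eq_zero fun l _ => ?_
  rw [extRightMul_eq 𝒜 (h l), Abelian.Ext.comp_assoc_of_second_deg_zero, hx' l,
    Abelian.Ext.comp_zero]

lemma finite_koszulDual [Fintype Λ] [FiniteDimensional k A] (hs : IsStandardlyStratified e)
    (he : CompleteOrthogonalIdempotents e)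
    (h : ∀ l, ∀ x : projMod e l, x ∈ stdKer e l ↔ (x : A) ∈ posIdeal 𝒜) :
    FiniteDimensional k (KoszulDual 𝒜) := by
  let Y := ModuleCat.of A (degZeroMod 𝒜)
  have hfin : ∀ n, Module.Finite k (Abelian.Ext.{u} Y Y n) := fun n => by
    have := fun l => hs.finite_ext (k := k) he.idem Y l n
    exact Module.Finite.of_injective _ (injective_precomp_stdIncl 𝒜 he h Y n)
  choose N hN using hs.exists_hasProjectiveDimensionLT he.idem
  -- The sum of the individual bounds `N l` serves as a common bound.
  have hzero : ∀ n, ∑ l, N l ≤ n → Subsingleton (Abelian.Ext.{u} Y Y n) := fun n hn => by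
    have : ∀ l, Subsingleton (Abelian.Ext.{u} (ModuleCat.of A (stdMod e l)) Y n) := fun l =>
      HasProjectiveDimensionLT.subsingleton _ (N l) n
        ((Finset.single_le_sum (fun _ _ => Nat.zero_le _) (Finset.mem_univ l)).trans hn) Y
    exact (injective_precomp_stdIncl (k := k) 𝒜 he h Y n).subsingleton
  let F : (⨁ n : ℕ, Abelian.Ext.{u} Y Y n) →ₗ[k]
      ∀ i : Fin (∑ l, N l), Abelian.Ext.{u} Y Y (i : ℕ) :=
    LinearMap.pi fun i => DirectSum.component k ℕ (fun n => Abelian.Ext.{u} Y Y n) i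
  refine Module.Finite.of_injective F ((injective_iff_map_eq_zero F).mpr fun x hx => ?_)
  ext n
  rcases lt_or_ge n (∑ l, N l) with hn | hn
  · exact congrFun hx ⟨n, hn⟩
  · exact (hzero n hn).elim _ _

end Dual

/-! ### The main theorem. -/

theorem theorem7p1
    {k : Type w} [Field k] [IsAlgClosed k]
    {A : Type u} [Ring A] [Algebra k A] [FiniteDimensional k A]
    (𝒜 : ℕ → Submodule k A) [GradedAlgebra 𝒜]
    (hself : IsSelfInjective (𝒜 0))
    {Λ : Type*} [Fintype Λ] [PartialOrder Λ]
    (e : Λ → A) (he : IsBasicSystem e) (he0 : ∀ l, e l ∈ 𝒜 0)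
    (hstrat : IsStandardlyStratified e)
    (hdeg : ∀ l, ConcentratedInDegree (stdDeg 𝒜 e l) 0)
    (hkoszul : ∀ l, IsKoszulModule 𝒜 (stdDeg 𝒜 e l)) :
    Nonempty (degZeroMod 𝒜 ≃ₗ[A] ⨁ l, stdMod e l) ∧
    FiniteDimensional k (KoszulDual 𝒜) ∧
    IsBasicSystem (fun l : Λᵒᵈ => dualIdem 𝒜 (e (OrderDual.ofDual l))) ∧
    IsStandardlyStratified (fun l : Λᵒᵈ => dualIdem 𝒜 (e (OrderDual.ofDual l))) := by
  have h : ∀ l, ∀ x : projMod e l, x ∈ stdKer e l ↔ (x : A) ∈ posIdeal 𝒜 := fun _ =>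
    mem_stdKer_iff 𝒜 he he0 hdeg hkoszul
  have hcoi : CompleteOrthogonalIdempotents
      fun l : Λᵒᵈ => dualIdem 𝒜 (e (OrderDual.ofDual l)) :=
    completeOrthogonalIdempotents_dualIdem 𝒜 ((CompleteOrthogonalIdempotents.equiv OrderDual.ofDual).mpr he.complete)
  have hprim : ∀ l : Λᵒᵈ, IsPrimitiveIdem (dualIdem 𝒜 (e (OrderDual.ofDual l))) := fun l =>
    (he.primitive _).dualIdem 𝒜 (he0 _)
  have hdir : ∀ l m : Λᵒᵈ, ¬ m ≤ l → ∀ x, dualIdem 𝒜 (e (OrderDual.ofDual m)) * x *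
      dualIdem 𝒜 (e (OrderDual.ofDual l)) = 0 := fun l m hlm x =>
    dualIdem_mul_mul_dualIdem_eq_zero 𝒜 hstrat he.complete.idem h hlm x
  refine ⟨degZeroMod_equiv 𝒜 he.complete h, finite_koszulDual 𝒜 hstrat he.complete h,
    ⟨hcoi, hprim, ?_⟩, isStandardlyStratified_of_directed hcoi.idem hdir⟩
  rintro l m ⟨f⟩
  exact le_antisymm (le_of_projMod_equiv hcoi.idem (fun l => (hprim l).2.1) hdir f)
    (le_of_projMod_equiv hcoi.idem (fun l => (hprim l).2.1) hdir f.symm)
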